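/- (p-biased invariance principle.) Let $\sigma_1,\dots,\sigma_n>0$, and let $\mathbf X=(X_1,\dots,X_n)$ and $\mathbf Y=(Y_1,\dots,Y_n)$ be random vectors (possibly on different probability spaces), each with independent real-valued coordinates, such that for every $i$ the variables $X_i$ and $Y_i$ have mean $0$ and variance $1$ and satisfy $\|X_i\|_3^3\le\sigma_i^{-1}$ and $\|Y_i\|_3^3\le\sigma_i^{-1}$, where $\|Z\|_3^3=\mathbb E|Z|^3$. Let $f\in\mathbb R[v_1,\dots,v_n]$ be a multilinear polynomial of degree at most $d$, and for $S\subset[n]$ let $\hat f(S)$ be the coefficient in $f$ of $v_S=\prod_{i\in S}v_i$. Put $$W_S(f)=\sum_{J\supseteq S}\hat f(J)^2,\qquad \mathrm I_S(f)=W_S(f)\prod_{i\in S}\sigma_i^{-2}.$$ Let $\phi:\mathbb R\to\mathbb R$ be three times continuously differentiable with $\|\phi'''\|_\infty=\sup_{x\in\mathbb R}|\phi'''(x)|<\infty$. If $\epsilon$ is a real number with $\mathrm I_S(f)\le\epsilon$ for every nonempty $S\subset[n]$, then $\phi(f(\mathbf X))$ and $\phi(f(\mathbf Y))$ are integrable and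 $$\bigl|\mathbb E[\phi(f(\mathbf X))]-\mathbb E[\phi(f(\mathbf Y))]\bigr|\le 2^{5d}\,\|\phi'''\|_\infty\,W_\emptyset(f)\,\sqrt\epsilon .$$ (If $n=0$ there is no nonempty $S$ and $\epsilon$ is unrestricted; then $\sqrt\epsilon$ is read as $0$ for $\epsilon<0$.) -/

import Mathlib

open MeasureTheory ProbabilityTheory

namespace Invariance

/-- A polynomial is multilinear if every variable occurs in it with degree at most one. -/
def IsMultilinear {n : ℕ} (f : MvPolynomial (Fin n) ℝ) : Prop :=
  ∀ i, f.degreeOf i ≤ 1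

/-- The coefficient in `f` of the monomial `v_S = ∏_{i ∈ S} v_i`. -/
noncomputable def monomialCoeff {n : ℕ} (f : MvPolynomial (Fin n) ℝ) (S : Finset (Fin n)) : ℝ :=
  f.coeff (∑ i ∈ S, Finsupp.single i 1)

/-- `W_S(f)`, the sum of the squared coefficients of `v_J` over all `J ⊇ S`. -/
noncomputable def upWeight {n : ℕ} (f : MvPolynomial (Fin n) ℝ) (S : Finset (Fin n)) : ℝ :=
  ∑ J : Finset (Fin n) with S ⊆ J, monomialCoeff f J ^ 2

/-- The generalised influence `I_S(f) = W_S(f) ∏_{i ∈ S} σ_i⁻²`. -/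
noncomputable def genInfluence {n : ℕ} (σ : Fin n → ℝ) (f : MvPolynomial (Fin n) ℝ)
    (S : Finset (Fin n)) : ℝ :=
  upWeight f S * ∏ i ∈ S, (σ i ^ 2)⁻¹

/-- A random vector with independent coordinates of mean `0` and variance `1`, whose `i`-th
coordinate satisfies `‖X_i‖₃³ ≤ σ_i⁻¹`. -/
structure IsAdmissible {n : ℕ} {Ω : Type*} [MeasurableSpace Ω] (P : Measure Ω)
    (σ : Fin n → ℝ) (X : Fin n → Ω → ℝ) : Prop where
  measurable : ∀ i, Measurable (X i)
  indep : iIndepFun X P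
  mean : ∀ i, ∫ ω, X i ω ∂P = 0
  variance : ∀ i, ProbabilityTheory.variance (X i) P = 1
  third_moment : ∀ i, eLpNorm (X i) 3 P ^ 3 ≤ ENNReal.ofReal (σ i)⁻¹

/-- The random variable `f(X)`. -/
noncomputable def evalAt {n : ℕ} {Ω : Type*} (f : MvPolynomial (Fin n) ℝ)
    (X : Fin n → Ω → ℝ) (ω : Ω) : ℝ :=
  MvPolynomial.eval (fun i => X i ω) f

/-- `‖φ'''‖_∞`, the supremum of `|φ'''|` (used for `φ` of class `C³` with `φ'''` bounded). -/
noncomputable def thirdDerivSup (φ : ℝ → ℝ) : ℝ :=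
  ⨆ x, |iteratedDeriv 3 φ x|

end Invariance

/-! The proof is Lindeberg replacement. Swapping `X_i` for `Y_i` leaves the second-order Taylor part
of `φ` unchanged, because the first two moments agree; the cost is at most `‖φ'''‖/3 · σ_i⁻¹ · E|∂_i
f|³`, under a product law with some coordinates from each vector (`abs_integral_update_sub_le`).

That third moment needs a substitute for hypercontractivity, which fails for general laws. Trading a
coordinate for a random sign costs only `σ_i⁻¹ E|∂_i g|³`; iterating gives `E|g|³ ≤ ∑_S ∏_{i∈S}
σ_i⁻¹ · E|∂_S g|³` with random signs on the right (`integral_abs_pow_three_le_sum`). For signs,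
`integral_abs_pow_three_rademacher_le` bounds third moments by coefficients.

With `g = ∂_i f`, and after renaming `S ∪ {i}` as `S`, each summand is at most `8^d ∏ σ_j⁻¹
W_S^{3/2} = 8^d √I_S · W_S ≤ 8^d √ε W_S`. Summing the weights over `i` and `S` gives at most `d 2^d
W_∅`. -/

namespace Invariance

/-! ### Multilinear polynomials as coefficient functions -/

section Coefficients

variable {ι : Type*}

/-- The multilinear polynomial with coefficients `a`, as a function. -/
noncomputable def multilinearEval [Fintype ι] (a : Finset ι → ℝ) (x : ι → ℝ) : ℝ :=
  ∑ J, a J * ∏ i ∈ J, x i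

/-- The coefficients of the part of a multilinear polynomial that does not involve `v_i`. -/
def dropVar [DecidableEq ι] (i : ι) (a : Finset ι → ℝ) (J : Finset ι) : ℝ :=
  if i ∈ J then 0 else a J

/-- The coefficients of the iterated partial derivative with respect to the variables in `S`. -/
def derivOn [DecidableEq ι] (S : Finset ι) (a : Finset ι → ℝ) (J : Finset ι) : ℝ :=
  if Disjoint S J then a (S ∪ J) else 0

/-- The squared `ℓ²`-norm of the coefficients in which degree `k` has weight `3 ^ k`. -/
def weightedSq [Fintype ι] (a : Finset ι → ℝ) : ℝ :=
  ∑ J, 3 ^ J.card * a J ^ 2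

lemma weightedSq_nonneg [Fintype ι] (a : Finset ι → ℝ) : 0 ≤ weightedSq a :=
  Finset.sum_nonneg fun _ _ => by positivity

lemma sum_finset_split [Fintype ι] [DecidableEq ι] (i : ι) (F : Finset ι → ℝ) :
    ∑ J, F J = ∑ J ∈ (Finset.univ.erase i).powerset, (F J + F (insert i J)) := by
  rw [Finset.sum_add_distrib, ← Finset.sum_powerset_insert (Finset.notMem_erase i _),
    Finset.insert_erase (Finset.mem_univ i), Finset.powerset_univ]

lemma dropVar_of_notMem [DecidableEq ι] {i : ι} {J : Finset ι} (h : i ∉ J) (a : Finset ι → ℝ) :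
    dropVar i a J = a J := if_neg h

lemma dropVar_insert [DecidableEq ι] (i : ι) (J : Finset ι) (a : Finset ι → ℝ) :
    dropVar i a (insert i J) = 0 := if_pos (Finset.mem_insert_self _ _)

lemma derivOn_singleton_of_notMem [DecidableEq ι] {i : ι} {J : Finset ι} (h : i ∉ J) (a : Finset ι → ℝ) :
    derivOn {i} a J = a (insert i J) := by
  rw [derivOn, if_pos (by simpa using h), Finset.insert_eq]

lemma derivOn_singleton_insert [DecidableEq ι] (i : ι) (J : Finset ι) (a : Finset ι → ℝ) :
    derivOn {i} a (insert i J) = 0 := by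
  simp [derivOn]

lemma derivOn_empty [DecidableEq ι] (a : Finset ι → ℝ) : derivOn ∅ a = a := by
  ext J; simp [derivOn]

lemma derivOn_derivOn_singleton [DecidableEq ι] {i : ι} {S : Finset ι} (h : i ∉ S) (a : Finset ι → ℝ) :
    derivOn S (derivOn {i} a) = derivOn (insert i S) a := by
  ext J
  by_cases hi : i ∈ J <;> by_cases hd : Disjoint S J <;>
    simp [derivOn, hi, hd, h]

lemma derivOn_derivOn_singleton_of_mem [DecidableEq ι] {i : ι} {S : Finset ι} (h : i ∈ S) (a : Finset ι → ℝ) :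
    derivOn S (derivOn {i} a) = 0 := by
  ext J
  simp [derivOn, h]

/-- This recursion drives the hypercontractive induction; its factor 3 is the one in `cubic_add_le`.
-/
lemma weightedSq_split [Fintype ι] [DecidableEq ι] (i : ι) (a : Finset ι → ℝ) :
    weightedSq a = weightedSq (dropVar i a) + 3 * weightedSq (derivOn {i} a) := by
  simp only [weightedSq]
  rw [sum_finset_split i, sum_finset_split i (fun J => 3 ^ J.card * dropVar i a J ^ 2),
    sum_finset_split i (fun J => 3 ^ J.card * derivOn {i} a J ^ 2), Finset.mul_sum,
    ← Finset.sum_add_distrib]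
  refine Finset.sum_congr rfl fun J hJ => ?_
  have hi : i ∉ J := fun h => by simpa using Finset.mem_powerset.1 hJ h
  rw [dropVar_insert, derivOn_singleton_insert, dropVar_of_notMem hi,
    derivOn_singleton_of_notMem hi, Finset.card_insert_of_notMem hi]
  ring

lemma multilinearEval_update [Fintype ι] [DecidableEq ι] (i : ι) (a : Finset ι → ℝ) (x : ι → ℝ) (t : ℝ) :
    multilinearEval a (Function.update x i t) =
      multilinearEval (dropVar i a) x + t * multilinearEval (derivOn {i} a) x := by
  simp only [multilinearEval]
  rw [sum_finset_split i, sum_finset_split i (fun J => dropVar i a J * ∏ j ∈ J, x j),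
    sum_finset_split i (fun J => derivOn {i} a J * ∏ j ∈ J, x j), Finset.mul_sum,
    ← Finset.sum_add_distrib]
  refine Finset.sum_congr rfl fun J hJ => ?_
  have hi : i ∉ J := fun h => by simpa using Finset.mem_powerset.1 hJ h
  have h1 : ∏ j ∈ J, Function.update x i t j = ∏ j ∈ J, x j :=
    Finset.prod_congr rfl fun j hj => Function.update_of_ne (fun h => hi (by rwa [← h])) _ _
  rw [dropVar_insert, derivOn_singleton_insert, dropVar_of_notMem hi,
    derivOn_singleton_of_notMem hi, Finset.prod_insert hi, h1, Function.update_self]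
  ring

end Coefficients

/-! ### Product measures -/

section ProductMeasure

variable {ι : Type*}

/-- Resampling one coordinate of a product measure. -/
lemma measurePreserving_update [Fintype ι] [DecidableEq ι] (μ : ι → Measure ℝ) [∀ i, IsProbabilityMeasure (μ i)]
    (i : ι) (ν : Measure ℝ) [IsProbabilityMeasure ν] :
    MeasurePreserving (fun p : (ι → ℝ) × ℝ => Function.update p.1 i p.2)
      ((Measure.pi μ).prod ν) (Measure.pi (Function.update μ i ν)) := by
  have hm : Measurable fun p : (ι → ℝ) × ℝ => Function.update p.1 i p.2 := by
    refine measurable_pi_iff.2 fun j => ?_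
    by_cases h : j = i
    · subst h; simpa using measurable_snd
    · simpa [Function.update_of_ne h] using (measurable_pi_apply j).fun_comp measurable_fst
  have : ∀ j, IsProbabilityMeasure (Function.update μ i ν j) := fun j => by
    by_cases h : j = i
    · subst h; simpa
    · simpa [Function.update_of_ne h] using inferInstanceAs (IsProbabilityMeasure (μ j))
  refine ⟨hm, (Measure.pi_eq fun s hs => ?_).symm⟩
  rw [Measure.map_apply hm (MeasurableSet.univ_pi hs)]
  -- The old `i`-th coordinate is overwritten, hence unconstrained, and contributes a factor 1.
  have h1 : (fun p : (ι → ℝ) × ℝ => Function.update p.1 i p.2) ⁻¹' Set.univ.pi s =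
      (Set.univ.pi (Function.update s i Set.univ)) ×ˢ s i := by
    ext p
    simp only [Set.mem_preimage, Set.mem_pi, Set.mem_univ, true_imp_iff, Set.mem_prod]
    constructor
    · refine fun h => ⟨fun j => ?_, by simpa using h i⟩
      by_cases hj : j = i
      · subst hj; simp
      · simpa [hj] using h j
    · rintro ⟨h, h'⟩ j
      by_cases hj : j = i
      · subst hj; simpa using h'
      · simpa [hj] using h j
  rw [h1, Measure.prod_prod, Measure.pi_pi, ← Finset.mul_prod_erase _ _ (Finset.mem_univ i),
    ← Finset.mul_prod_erase _ _ (Finset.mem_univ i)]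
  simp only [Function.update_self, measure_univ, one_mul]
  rw [mul_comm]
  congr 1
  refine Finset.prod_congr rfl fun j hj => ?_
  have hj := Finset.ne_of_mem_erase hj
  simp [hj]

end ProductMeasure

/-! ### One-variable third-moment inequalities -/

section Moments

/-- A probability measure on `ℝ` of mean `0` and variance `1` whose third absolute moment is at
most `κ`. -/
structure IsStandard (κ : ℝ) (μ : Measure ℝ) : Prop where
  prob : IsProbabilityMeasure μ
  memLp : MemLp id 3 μ
  mean : ∫ t, t ∂μ = 0
  second : ∫ t, t ^ 2 ∂μ = 1
  third : ∫ t, |t| ^ 3 ∂μ ≤ κ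

lemma integrable_abs_pow_three {α : Type*} [MeasurableSpace α] {μ : Measure α} {f : α → ℝ}
    (hf : MemLp f 3 μ) : Integrable (fun x => |f x| ^ 3) μ := by
  have := hf.integrable_norm_pow (by norm_num : (3 : ℕ) ≠ 0)
  simpa [Real.norm_eq_abs] using this

lemma memLp_three_of_integrable {α : Type*} [MeasurableSpace α] {μ : Measure α} {f : α → ℝ}
    (hm : AEStronglyMeasurable f μ) (hf : Integrable (fun x => |f x| ^ 3) μ) : MemLp f 3 μ := by
  rw [← integrable_norm_rpow_iff hm (by norm_num) (by norm_num)]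
  refine hf.congr (Filter.Eventually.of_forall fun x => ?_)
  simp only [Real.norm_eq_abs, ENNReal.toReal_ofNat]
  norm_cast

/-- The linear term is kept exact so that it integrates to zero. When `a` and `a + t` have opposite
signs, the inequality rests on `4(a² + 3at + 3t²) = (2a + 3t)² + 3t²`. -/
lemma abs_add_pow_three_le (a t : ℝ) :
    |a + t| ^ 3 ≤ |a| ^ 3 + 3 * (a * |a|) * t + 3 * |a| * t ^ 2 + |t| ^ 3 := by
  rcases abs_cases a with ⟨h1, h1'⟩ | ⟨h1, h1'⟩ <;> rcases abs_cases t with ⟨h2, h2'⟩ | ⟨h2, h2'⟩ <;>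
    rcases abs_cases (a + t) with ⟨h3, h3'⟩ | ⟨h3, h3'⟩ <;> rw [h1, h2, h3] <;>
    nlinarith [mul_nonneg (abs_nonneg a) (sq_nonneg (2 * a + 3 * t)), mul_nonneg (abs_nonneg a) (sq_nonneg t), mul_nonneg (abs_nonneg a) (sq_nonneg a)]

/-- Triangle inequality for the cubes, whose sum is `2a(a² + 3b²)`. The right side is the third
moment with a random sign. -/
lemma abs_pow_three_add_le (a b : ℝ) :
    |a| ^ 3 + 3 * |a| * b ^ 2 ≤ (|a + b| ^ 3 + |a - b| ^ 3) / 2 := by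
  have h : |a| ^ 3 + 3 * |a| * b ^ 2 = |(a + b) ^ 3 + (a - b) ^ 3| / 2 := by
    rw [show (a + b) ^ 3 + (a - b) ^ 3 = 2 * (a * (a ^ 2 + 3 * b ^ 2)) by ring, abs_mul, abs_mul,
      abs_of_nonneg (by positivity : 0 ≤ a ^ 2 + 3 * b ^ 2), abs_two, ← sq_abs a]
    ring
  rw [h, ← abs_pow, ← abs_pow]
  linarith [abs_add_le ((a + b) ^ 3) ((a - b) ^ 3)]


lemma IsStandard.integrable_comp {κ : ℝ} {μ : Measure ℝ} (h : IsStandard κ μ) (a b c e : ℝ) :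
    Integrable (fun t => a + b * t + c * t ^ 2 + e * |t| ^ 3) μ := by
  have := h.prob
  have h1 : Integrable (fun t : ℝ => t) μ := h.memLp.integrable (by norm_num)
  have h2 : Integrable (fun t : ℝ => t ^ 2) μ :=
    (h.memLp.mono_exponent (by norm_num : (2 : ENNReal) ≤ 3)).integrable_sq
  exact (((integrable_const a).add (h1.const_mul b)).add (h2.const_mul c)).add
    ((integrable_abs_pow_three h.memLp).const_mul e)

lemma IsStandard.integral_comp {κ : ℝ} {μ : Measure ℝ} (h : IsStandard κ μ) (a b c e : ℝ) :
    ∫ t, (a + b * t + c * t ^ 2 + e * |t| ^ 3) ∂μ = a + c + e * ∫ t, |t| ^ 3 ∂μ := by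
  have := h.prob
  have h1 : Integrable (fun t : ℝ => t) μ := h.memLp.integrable (by norm_num)
  have h2 : Integrable (fun t : ℝ => t ^ 2) μ :=
    (h.memLp.mono_exponent (by norm_num : (2 : ENNReal) ≤ 3)).integrable_sq
  have h3 : Integrable (fun t : ℝ => |t| ^ 3) μ := integrable_abs_pow_three h.memLp
  have h4 : Integrable (fun t : ℝ => a + b * t) μ := (integrable_const a).add (h1.const_mul b)
  have h5 : Integrable (fun t : ℝ => a + b * t + c * t ^ 2) μ := h4.add (h2.const_mul c)
  rw [integral_add h5 (h3.const_mul e), integral_add h4 (h2.const_mul c),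
    integral_add (integrable_const a) (h1.const_mul b), integral_const_mul, integral_const_mul,
    integral_const_mul, h.mean, h.second]
  simp

lemma IsStandard.memLp_affine {κ : ℝ} {μ : Measure ℝ} (h : IsStandard κ μ) (a b : ℝ) :
    MemLp (fun t => a + t * b) 3 μ := by
  have := h.prob
  refine (memLp_const a).add ?_
  simpa [mul_comm] using h.memLp.const_mul b

lemma IsStandard.integral_abs_pow_three_le {κ : ℝ} {μ : Measure ℝ} (h : IsStandard κ μ)
    (a b : ℝ) :
    ∫ t, |a + t * b| ^ 3 ∂μ ≤ |a| ^ 3 + 3 * |a| * b ^ 2 + κ * |b| ^ 3 := by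
  have h1 : ∫ t, |a + t * b| ^ 3 ∂μ ≤
      ∫ t, (|a| ^ 3 + (3 * (a * |a|) * b) * t + (3 * |a| * b ^ 2) * t ^ 2 + |b| ^ 3 * |t| ^ 3) ∂μ := by
    refine integral_mono (integrable_abs_pow_three (h.memLp_affine a b))
      (h.integrable_comp _ _ _ _) fun t => ?_
    refine (abs_add_pow_three_le a (t * b)).trans (le_of_eq ?_)
    rw [abs_mul]
    ring
  rw [h.integral_comp] at h1
  nlinarith [h.third, pow_nonneg (abs_nonneg b) 3]

/-- The law of a uniform random sign. -/
noncomputable def rademacher : Measure ℝ :=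
  (2⁻¹ : ENNReal) • Measure.dirac 1 + (2⁻¹ : ENNReal) • Measure.dirac (-1)

lemma integral_rademacher (F : ℝ → ℝ) : ∫ t, F t ∂rademacher = (F 1 + F (-1)) / 2 := by
  have hi (c : ℝ) : Integrable F ((2⁻¹ : ENNReal) • Measure.dirac c) :=
    (integrable_dirac (by simp)).smul_measure (by simp)
  rw [rademacher, integral_add_measure (hi 1) (hi (-1)), integral_smul_measure,
    integral_smul_measure, integral_dirac, integral_dirac]
  simp
  ring

lemma isStandard_rademacher : IsStandard 1 rademacher where
  prob := ⟨by simp [rademacher, ENNReal.inv_two_add_inv_two]⟩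
  memLp := by
    refine memLp_three_of_integrable aestronglyMeasurable_id ?_
    exact ((integrable_dirac (by simp)).smul_measure (by simp)).add_measure
      ((integrable_dirac (by simp)).smul_measure (by simp))
  mean := by rw [integral_rademacher]; norm_num
  second := by rw [integral_rademacher]; norm_num
  third := by rw [integral_rademacher]; norm_num

lemma IsStandard.integral_abs_pow_three_le_rademacher {κ : ℝ} {μ : Measure ℝ}
    (h : IsStandard κ μ) (a b : ℝ) :
    ∫ t, |a + t * b| ^ 3 ∂μ ≤ (∫ t, |a + t * b| ^ 3 ∂rademacher) + κ * |b| ^ 3 := by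
  refine (h.integral_abs_pow_three_le a b).trans ?_
  rw [integral_rademacher]
  have := abs_pow_three_add_le a b
  rw [one_mul, neg_one_mul, ← sub_eq_add_neg]
  linarith

lemma isStandard_update {ι : Type*} [DecidableEq ι] {κ : ι → ℝ} {μ : ι → Measure ℝ} (h : ∀ i, IsStandard (κ i) (μ i))
    (i : ι) {c : ℝ} {ν : Measure ℝ} (hν : IsStandard c ν) (j : ι) :
    IsStandard (Function.update κ i c j) (Function.update μ i ν j) := by
  by_cases hj : j = i
  · subst hj; simpa
  · simpa [hj] using h j

end Moments

/-! ### Third moments of multilinear polynomials -/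

section CubicBounds

variable {ι : Type*} [Fintype ι]

/-- Multilinear polynomials have finite third moments under products of standard measures. -/
lemma memLp_multilinearEval {κ : ι → ℝ} {μ : ι → Measure ℝ} (h : ∀ i, IsStandard (κ i) (μ i))
    (a : Finset ι → ℝ) : MemLp (multilinearEval a) 3 (Measure.pi μ) := by
  classical
  have := fun i => (h i).prob
  refine memLp_finsetSum _ fun J _ => MemLp.const_mul ?_ (a J)
  refine memLp_three_of_integrable (by fun_prop) ?_
  -- Padding with the constant 1 outside `J` turns the monomial into a product over all coordinates.
  have h1 : (fun x : ι → ℝ => |∏ i ∈ J, x i| ^ 3) =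
      fun x => ∏ i, (if i ∈ J then fun t : ℝ => |t| ^ 3 else fun _ => 1) (x i) := by
    ext x
    rw [Finset.abs_prod, ← Finset.prod_pow, ← Finset.prod_subset (Finset.subset_univ J)]
    · exact Finset.prod_congr rfl fun i hi => by rw [if_pos hi]
    · exact fun i _ hi => by rw [if_neg hi]
  rw [h1]
  refine Integrable.fintype_prod fun i => ?_
  by_cases hi : i ∈ J
  · simpa [hi] using integrable_abs_pow_three (h i).memLp
  · simp [hi]

variable [DecidableEq ι]

/-- Integration against a product measure, with one coordinate singled out. -/
lemma integral_pi_update {μ : ι → Measure ℝ} [∀ i, IsProbabilityMeasure (μ i)]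
    (i : ι) (ν : Measure ℝ) [IsProbabilityMeasure ν] {a : Finset ι → ℝ} {F : ℝ → ℝ}
    (hF : Integrable (fun x => F (multilinearEval a x)) (Measure.pi (Function.update μ i ν))) :
    Integrable (fun x => ∫ t, F (multilinearEval (dropVar i a) x +
        t * multilinearEval (derivOn {i} a) x) ∂ν) (Measure.pi μ) ∧
    ∫ x, F (multilinearEval a x) ∂(Measure.pi (Function.update μ i ν)) =
      ∫ x, ∫ t, F (multilinearEval (dropVar i a) x +
        t * multilinearEval (derivOn {i} a) x) ∂ν ∂(Measure.pi μ) := by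
  have hp := measurePreserving_update μ i ν
  have h1 := hp.integrable_comp_of_integrable hF
  have h2 : (∫ x, F (multilinearEval a x) ∂(Measure.pi (Function.update μ i ν))) =
      ∫ p, F (multilinearEval a (Function.update p.1 i p.2)) ∂((Measure.pi μ).prod ν) := by
    rw [← hp.map_eq, integral_map hp.measurable.aemeasurable]
    rw [hp.map_eq]
    exact hF.aestronglyMeasurable
  have h3 := h1.integral_prod_left
  simp only [Function.comp_def] at h1 h3
  rw [h2, integral_prod _ h1]
  simpa only [multilinearEval_update, and_true] using h3

/-- The third moment of a multilinear polynomial increases by at most a third moment of the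
derivative when a coordinate replaces a random sign. -/
lemma integral_abs_pow_three_update_le {κ : ι → ℝ} {μ : ι → Measure ℝ}
    (h : ∀ i, IsStandard (κ i) (μ i)) (i : ι) {c : ℝ} {ν : Measure ℝ} (hν : IsStandard c ν)
    (a : Finset ι → ℝ) :
    ∫ x, |multilinearEval a x| ^ 3 ∂(Measure.pi (Function.update μ i ν)) ≤
      (∫ x, |multilinearEval a x| ^ 3 ∂(Measure.pi (Function.update μ i rademacher))) +
      c * ∫ x, |multilinearEval (derivOn {i} a) x| ^ 3 ∂(Measure.pi μ) := by
  have := fun i => (h i).prob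
  have := hν.prob
  have := isStandard_rademacher.prob
  have hint (ρ) (c' : ℝ) (hρ : IsStandard c' ρ) :=
    integrable_abs_pow_three (memLp_multilinearEval (isStandard_update h i hρ) a)
  obtain ⟨h1, h1'⟩ := integral_pi_update i ν (F := fun t => |t| ^ 3) (hint _ _ hν)
  obtain ⟨h2, h2'⟩ := integral_pi_update i rademacher (F := fun t => |t| ^ 3)
    (hint _ _ isStandard_rademacher)
  have h3 := (integrable_abs_pow_three (memLp_multilinearEval h (derivOn {i} a))).const_mul c
  rw [h1', h2', ← integral_const_mul, ← integral_add h2 h3]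
  exact integral_mono h1 (h2.add h3) fun x => hν.integral_abs_pow_three_le_rademacher _ _

/-- Comparison of third moments with random signs. -/
lemma integral_abs_pow_three_le_sum {κ : ι → ℝ} {μ : ι → Measure ℝ}
    (h : ∀ i, IsStandard (κ i) (μ i)) (s : Finset ι) (a : Finset ι → ℝ) :
    ∫ x, |multilinearEval a x| ^ 3 ∂(Measure.pi (s.piecewise μ fun _ => rademacher)) ≤
      ∑ S ∈ s.powerset, (∏ i ∈ S, κ i) *
        ∫ x, |multilinearEval (derivOn S a) x| ^ 3 ∂(Measure.pi fun _ => rademacher) := by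
  induction s using Finset.induction_on generalizing a with
  | empty => simp [derivOn_empty]
  | insert i s hi ih =>
    have hκ : 0 ≤ κ i := le_trans (integral_nonneg fun t => by positivity) (h i).third
    have hst : ∀ j, IsStandard (s.piecewise κ (fun _ => 1) j)
        (s.piecewise μ (fun _ => rademacher) j) := fun j => by
      by_cases hj : j ∈ s
      · simpa [hj] using h j
      · simpa [hj] using isStandard_rademacher
    have hup : Function.update (s.piecewise μ fun _ => rademacher) i rademacher =
        s.piecewise μ fun _ => rademacher := by
      rw [Function.update_eq_self_iff, Finset.piecewise_eq_of_notMem _ _ _ hi]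
    have key := integral_abs_pow_three_update_le hst i (h i) a
    rw [hup] at key
    rw [Finset.piecewise_insert, Finset.sum_powerset_insert hi]
    refine key.trans (add_le_add (ih a) ?_)
    -- The inductive bound for the derivative supplies exactly the subsets that contain `i`.
    refine (mul_le_mul_of_nonneg_left (ih (derivOn {i} a)) hκ).trans (le_of_eq ?_)
    rw [Finset.mul_sum]
    refine Finset.sum_congr rfl fun S hS => ?_
    have hiS : i ∉ S := fun h' => hi (Finset.mem_powerset.1 hS h')
    rw [Finset.prod_insert hiS, derivOn_derivOn_singleton hiS, mul_assoc]

/-- Hölder with exponents 3 and 3/2, obtained from Young's inequality so that no cube roots appear.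
-/
lemma integral_abs_mul_sq_le {α : Type*} [MeasurableSpace α] {μ : Measure α} {g h : α → ℝ}
    (hg : MemLp g 3 μ) (hh : MemLp h 3 μ) {A B : ℝ} (hA : 0 ≤ A) (hB : 0 ≤ B)
    (hgA : ∫ x, |g x| ^ 3 ∂μ ≤ A ^ 3) (hhB : ∫ x, |h x| ^ 3 ∂μ ≤ B ^ 3) :
    Integrable (fun x => |g x| * h x ^ 2) μ ∧ ∫ x, |g x| * h x ^ 2 ∂μ ≤ A * B ^ 2 := by
  have hIg := integrable_abs_pow_three hg
  have hIh := integrable_abs_pow_three hh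
  have young (p q : ℝ) (hp : 0 ≤ p) (hq : 0 ≤ q) : 3 * (p * q ^ 2) ≤ p ^ 3 + 2 * q ^ 3 := by
    nlinarith [mul_nonneg (by positivity : 0 ≤ p + 2 * q) (sq_nonneg (p - q))]
  have hint : Integrable (fun x => |g x| * h x ^ 2) μ := by
    refine (hIg.add (hIh.const_mul 2)).mono'
      (hg.aestronglyMeasurable.norm.mul (hh.aestronglyMeasurable.pow 2))
      (Filter.Eventually.of_forall fun x => ?_)
    have := young |g x| |h x| (abs_nonneg _) (abs_nonneg _)
    rw [sq_abs] at this
    rw [Real.norm_of_nonneg (by positivity)]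
    have h0 : 0 ≤ |g x| * h x ^ 2 := by positivity
    simp only [Pi.add_apply]
    linarith
  have vanish {k : α → ℝ} (hk : Integrable (fun x => |k x| ^ 3) μ)
      (h0 : ∫ x, |k x| ^ 3 ∂μ ≤ 0) : ∀ᵐ x ∂μ, k x = 0 := by
    have h1 := (integral_eq_zero_iff_of_nonneg (fun x => by positivity) hk).1
      (le_antisymm h0 (integral_nonneg fun x => by positivity))
    filter_upwards [h1] with x hx
    simpa using hx
  refine ⟨hint, ?_⟩
  rcases hA.eq_or_lt with rfl | hA
  · rw [integral_eq_zero_of_ae, zero_mul]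
    filter_upwards [vanish hIg (by simpa using hgA)] with x hx
    simp [hx]
  rcases hB.eq_or_lt with rfl | hB
  · rw [integral_eq_zero_of_ae]
    · simp
    filter_upwards [vanish hIh (by simpa using hhB)] with x hx
    simp [hx]
  -- Young at `p = B|g|`, `q = A|h|` balances both sides; dividing by `3A²B` afterwards is why zero
  -- bounds were treated separately.
  have key : ∫ x, 3 * A ^ 2 * B * (|g x| * h x ^ 2) ∂μ ≤
      ∫ x, (B ^ 3 * |g x| ^ 3 + 2 * A ^ 3 * |h x| ^ 3) ∂μ := by
    refine integral_mono (hint.const_mul _) ((hIg.const_mul _).add (hIh.const_mul _)) fun x => ?_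
    have := young (B * |g x|) (A * |h x|) (by positivity) (by positivity)
    rw [mul_pow A, sq_abs] at this
    linear_combination this
  rw [integral_const_mul, integral_add (hIg.const_mul _) (hIh.const_mul _), integral_const_mul,
    integral_const_mul] at key
  have h1 : 3 * A ^ 2 * B * ∫ x, |g x| * h x ^ 2 ∂μ ≤ 3 * A ^ 2 * B * (A * B ^ 2) := by
    have h2 := mul_le_mul_of_nonneg_left hgA (by positivity : 0 ≤ B ^ 3)
    have h3 := mul_le_mul_of_nonneg_left hhB (by positivity : 0 ≤ 2 * A ^ 3)
    linear_combination key + h2 + h3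
  exact le_of_mul_le_mul_left h1 (by positivity)

/-- The claim is `B³ ≤ C²(C - A)`, and `3B² = (C - A)(C + A) ≤ 2C(C - A)` gives it. Weight 2 in
place of 3 would match the `AB²` term but leave no room for `B³`. -/
lemma cubic_add_le {A B C : ℝ} (hA : 0 ≤ A) (hB : 0 ≤ B) (hC : 0 ≤ C)
    (h : C ^ 2 = A ^ 2 + 3 * B ^ 2) : A ^ 3 + 3 * (A * B ^ 2) + B ^ 3 ≤ C ^ 3 := by
  have h1 : A ≤ C := by nlinarith
  have h2 : B ≤ C := by nlinarith
  have h3 : 3 * B ^ 2 ≤ (C - A) * (2 * C) := by nlinarith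
  have h4 : B ^ 2 * B ≤ B ^ 2 * C := by gcongr
  nlinarith [mul_le_mul_of_nonneg_right h3 hC, mul_nonneg (sq_nonneg B) hC]

/-- Hypercontractivity for random signs, from `ℓ²` to `L³`. -/
lemma integral_abs_pow_three_rademacher_le (s : Finset ι) (a : Finset ι → ℝ)
    (ha : ∀ J, ¬ J ⊆ s → a J = 0) :
    ∫ x, |multilinearEval a x| ^ 3 ∂(Measure.pi fun _ : ι => rademacher) ≤
      √(weightedSq a) ^ 3 := by
  have hp := isStandard_rademacher.prob
  have hst : ∀ _ : ι, IsStandard 1 rademacher := fun _ => isStandard_rademacher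
  induction s using Finset.induction_on generalizing a with
  | empty =>
    have h0 : ∀ J, J ≠ ∅ → a J = 0 := fun J hJ => ha J (by simpa using hJ)
    have h1 : ∀ x, multilinearEval a x = a ∅ := fun x => by
      rw [multilinearEval, Finset.sum_eq_single ∅ (fun J _ hJ => by simp [h0 J hJ]) (by simp)]
      simp
    have h2 : weightedSq a = a ∅ ^ 2 := by
      rw [weightedSq, Finset.sum_eq_single ∅ (fun J _ hJ => by simp [h0 J hJ]) (by simp)]
      simp
    simp [h1, h2, Real.sqrt_sq_eq_abs]
  | insert i s hi ih =>
    -- Neither part of the splitting at `v_i` involves `v_i`, so both are supported on `s`.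
    have hg := ih (dropVar i a) fun J hJ => by
      by_cases hiJ : i ∈ J
      · simp [dropVar, hiJ]
      · rw [dropVar_of_notMem hiJ]
        exact ha J fun h' => hJ ((Finset.subset_insert_iff_of_notMem hiJ).1 h')
    have hh := ih (derivOn {i} a) fun J hJ => by
      by_cases hiJ : i ∈ J
      · simp [derivOn, hiJ]
      · rw [derivOn_singleton_of_notMem hiJ]
        exact ha _ fun h' => hJ ((Finset.subset_insert_iff_of_notMem hiJ).1
          ((Finset.subset_insert _ _).trans h'))
    have hmg := memLp_multilinearEval hst (dropVar i a)
    have hmh := memLp_multilinearEval hst (derivOn {i} a)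
    obtain ⟨hi1, hi2⟩ := integral_abs_mul_sq_le hmg hmh (Real.sqrt_nonneg _) (Real.sqrt_nonneg _)
      hg hh
    have hup : Function.update (fun _ : ι => rademacher) i rademacher = fun _ => rademacher := by
      simp
    obtain ⟨h1, h1'⟩ := integral_pi_update (μ := fun _ => rademacher) (a := a) i rademacher
      (F := fun t => |t| ^ 3)
      (by rw [hup]; exact integrable_abs_pow_three (memLp_multilinearEval hst a))
    rw [hup] at h1'
    have hIg := integrable_abs_pow_three hmg
    have hIh := integrable_abs_pow_three hmh
    rw [h1']
    calc _ ≤ ∫ x, (|multilinearEval (dropVar i a) x| ^ 3 +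
            3 * (|multilinearEval (dropVar i a) x| * multilinearEval (derivOn {i} a) x ^ 2) +
            |multilinearEval (derivOn {i} a) x| ^ 3) ∂(Measure.pi fun _ : ι => rademacher) := by
          refine integral_mono h1 ((hIg.add (hi1.const_mul 3)).add hIh) fun x => ?_
          refine (isStandard_rademacher.integral_abs_pow_three_le _ _).trans (le_of_eq ?_)
          ring
      _ ≤ √(weightedSq (dropVar i a)) ^ 3 + 3 * (√(weightedSq (dropVar i a)) *
            √(weightedSq (derivOn {i} a)) ^ 2) + √(weightedSq (derivOn {i} a)) ^ 3 := by
          rw [integral_add (by fun_prop) hIh, integral_add hIg (hi1.const_mul 3),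
            integral_const_mul]
          linarith
      _ ≤ _ := by
          refine cubic_add_le (Real.sqrt_nonneg _) (Real.sqrt_nonneg _) (Real.sqrt_nonneg _) ?_
          rw [Real.sq_sqrt (weightedSq_nonneg _), Real.sq_sqrt (weightedSq_nonneg _),
            Real.sq_sqrt (weightedSq_nonneg _), weightedSq_split i a]

end CubicBounds

/-! ### Taylor expansion and the replacement argument -/

section Lindeberg

lemma abs_sub_taylor_two_le {φ : ℝ → ℝ} (hφ : ContDiff ℝ 3 φ) {M : ℝ}
    (hM : ∀ x, |iteratedDeriv 3 φ x| ≤ M) (a u : ℝ) :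
    |φ (a + u) - (φ a + deriv φ a * u + iteratedDeriv 2 φ a / 2 * u ^ 2)| ≤ M / 6 * |u| ^ 3 := by
  rcases eq_or_ne u 0 with rfl | hu
  · simp
  have hne : a ≠ a + u := by simpa using hu
  obtain ⟨x', -, hx'⟩ := taylor_mean_remainder_lagrange_iteratedDeriv (n := 2) hne
    (by norm_num; exact hφ.contDiffOn)
  have hud : UniqueDiffOn ℝ (Set.uIcc a (a + u)) := uniqueDiffOn_uIcc hne
  have h1 : iteratedDerivWithin 1 φ (Set.uIcc a (a + u)) a = deriv φ a := by
    rw [iteratedDerivWithin_eq_iteratedDeriv hud (hφ.of_le (by norm_num)).contDiffAt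
      Set.left_mem_uIcc, iteratedDeriv_one]
  have h2 : iteratedDerivWithin 2 φ (Set.uIcc a (a + u)) a = iteratedDeriv 2 φ a :=
    iteratedDerivWithin_eq_iteratedDeriv hud (hφ.of_le (by norm_num)).contDiffAt
      Set.left_mem_uIcc
  rw [taylorWithinEval_succ, taylorWithinEval_succ, taylor_within_zero_eval, h1, h2] at hx'
  have h3 : φ (a + u) - (φ a + deriv φ a * u + iteratedDeriv 2 φ a / 2 * u ^ 2) =
      iteratedDeriv 3 φ x' / 6 * u ^ 3 := by
    norm_num [Nat.factorial] at hx'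
    linear_combination hx'
  rw [h3, abs_mul, abs_div, abs_pow]
  norm_num
  gcongr
  exact hM x'

/-- The quadratic Taylor polynomial at 0 is integrable, and the remainder is dominated by `M/6 ·
|F|³`. -/
lemma integrable_comp_of_memLp_three {α : Type*} [MeasurableSpace α] {μ : Measure α}
    [IsProbabilityMeasure μ] {φ : ℝ → ℝ} (hφ : ContDiff ℝ 3 φ) {M : ℝ}
    (hM : ∀ x, |iteratedDeriv 3 φ x| ≤ M) {F : α → ℝ} (hF : MemLp F 3 μ) :
    Integrable (fun x => φ (F x)) μ := by
  have h1 : Integrable F μ := hF.integrable (by norm_num)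
  have h2 : Integrable (fun x => F x ^ 2) μ :=
    (hF.mono_exponent (by norm_num : (2 : ENNReal) ≤ 3)).integrable_sq
  have h3 := integrable_abs_pow_three hF
  have hm : AEStronglyMeasurable (fun x => φ (F x)) μ :=
    hφ.continuous.comp_aestronglyMeasurable hF.aestronglyMeasurable
  have h4 : Integrable (fun x => φ 0 + deriv φ 0 * F x + iteratedDeriv 2 φ 0 / 2 * F x ^ 2) μ :=
    ((integrable_const _).add (h1.const_mul _)).add (h2.const_mul _)
  have h5 : Integrable (fun x => φ (F x) -
      (φ 0 + deriv φ 0 * F x + iteratedDeriv 2 φ 0 / 2 * F x ^ 2)) μ := by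
    refine (h3.const_mul (M / 6)).mono' (hm.sub h4.aestronglyMeasurable)
      (Filter.Eventually.of_forall fun x => ?_)
    simpa using abs_sub_taylor_two_le hφ hM 0 (F x)
  exact (h5.add h4).congr (Filter.Eventually.of_forall fun x => sub_add_cancel _ _)

/-- The subtracted value does not depend on `μ`, so two standard laws can be compared through it. -/
lemma IsStandard.abs_integral_comp_sub_le {κ : ℝ} {μ : Measure ℝ} (h : IsStandard κ μ)
    {φ : ℝ → ℝ} (hφ : ContDiff ℝ 3 φ) {M : ℝ} (hM : ∀ x, |iteratedDeriv 3 φ x| ≤ M) (a b : ℝ) :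
    |∫ t, φ (a + t * b) ∂μ - (φ a + iteratedDeriv 2 φ a / 2 * b ^ 2)| ≤
      M / 6 * κ * |b| ^ 3 := by
  have := h.prob
  have hM0 : 0 ≤ M := (abs_nonneg _).trans (hM 0)
  have h1 := integrable_comp_of_memLp_three hφ hM (h.memLp_affine a b)
  have h2 := h.integrable_comp (φ a) (deriv φ a * b) (iteratedDeriv 2 φ a / 2 * b ^ 2) 0
  have h3 := h.integral_comp (φ a) (deriv φ a * b) (iteratedDeriv 2 φ a / 2 * b ^ 2) 0
  rw [zero_mul, add_zero] at h3
  have h4 : Integrable (fun t : ℝ => M / 6 * |b| ^ 3 * |t| ^ 3) μ :=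
    (integrable_abs_pow_three h.memLp).const_mul _
  rw [← h3, ← integral_sub h1 h2]
  calc _ ≤ ∫ t, M / 6 * |b| ^ 3 * |t| ^ 3 ∂μ := by
        rw [← Real.norm_eq_abs]
        refine norm_integral_le_of_norm_le h4 (Filter.Eventually.of_forall fun t => ?_)
        have := abs_sub_taylor_two_le hφ hM a (t * b)
        rw [abs_mul] at this
        rw [Real.norm_eq_abs]
        convert this using 1
        · congr 1; ring
        · ring
    _ ≤ _ := by
        rw [integral_const_mul]
        nlinarith [mul_le_mul_of_nonneg_left h.third
          (by positivity : 0 ≤ M / 6 * |b| ^ 3)]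

lemma IsStandard.abs_integral_comp_sub_integral_comp_le {κ : ℝ} {μ ν : Measure ℝ}
    (h : IsStandard κ μ) (h' : IsStandard κ ν) {φ : ℝ → ℝ} (hφ : ContDiff ℝ 3 φ) {M : ℝ}
    (hM : ∀ x, |iteratedDeriv 3 φ x| ≤ M) (a b : ℝ) :
    |∫ t, φ (a + t * b) ∂μ - ∫ t, φ (a + t * b) ∂ν| ≤ M / 3 * κ * |b| ^ 3 := by
  have h1 := abs_le.1 (h.abs_integral_comp_sub_le hφ hM a b)
  have h2 := abs_le.1 (h'.abs_integral_comp_sub_le hφ hM a b)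
  rw [abs_le]
  constructor <;> linarith [h1.1, h1.2, h2.1, h2.2]

variable {ι : Type*} [Fintype ι] [DecidableEq ι]

/-- Replacing one coordinate in the Lindeberg method. -/
lemma abs_integral_update_sub_le {κ : ι → ℝ} {ρ : ι → Measure ℝ}
    (h : ∀ i, IsStandard (κ i) (ρ i)) (i : ι) {c : ℝ} {μ ν : Measure ℝ} (hμ : IsStandard c μ)
    (hν : IsStandard c ν) {φ : ℝ → ℝ} (hφ : ContDiff ℝ 3 φ) {M : ℝ}
    (hM : ∀ x, |iteratedDeriv 3 φ x| ≤ M) (a : Finset ι → ℝ) :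
    |∫ x, φ (multilinearEval a x) ∂(Measure.pi (Function.update ρ i μ)) -
        ∫ x, φ (multilinearEval a x) ∂(Measure.pi (Function.update ρ i ν))| ≤
      M / 3 * c * ∫ x, |multilinearEval (derivOn {i} a) x| ^ 3 ∂(Measure.pi ρ) := by
  have := fun i => (h i).prob
  have := hμ.prob
  have := hν.prob
  have hint (τ) (hτ : IsStandard c τ) :
      Integrable (fun x => φ (multilinearEval a x)) (Measure.pi (Function.update ρ i τ)) := by
    have := fun j => (isStandard_update h i hτ j).prob
    exact integrable_comp_of_memLp_three hφ hM (memLp_multilinearEval (isStandard_update h i hτ) a)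
  obtain ⟨h1, h1'⟩ := integral_pi_update i μ (hint _ hμ)
  obtain ⟨h2, h2'⟩ := integral_pi_update i ν (hint _ hν)
  have h3 := (integrable_abs_pow_three (memLp_multilinearEval h (derivOn {i} a))).const_mul
    (M / 3 * c)
  rw [h1', h2', ← integral_sub h1 h2, ← integral_const_mul, ← Real.norm_eq_abs]
  exact norm_integral_le_of_norm_le h3 (Filter.Eventually.of_forall fun x =>
    hμ.abs_integral_comp_sub_integral_comp_le hν hφ hM _ _)

/-- The Lindeberg method together with the hypercontractive bound for the derivatives. -/
lemma abs_integral_pi_sub_le {κ : ι → ℝ} {μ ν : ι → Measure ℝ}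
    (hμ : ∀ i, IsStandard (κ i) (μ i)) (hν : ∀ i, IsStandard (κ i) (ν i)) {φ : ℝ → ℝ}
    (hφ : ContDiff ℝ 3 φ) {M : ℝ} (hM : ∀ x, |iteratedDeriv 3 φ x| ≤ M) (a : Finset ι → ℝ)
    (s : Finset ι) :
    |∫ x, φ (multilinearEval a x) ∂(Measure.pi (s.piecewise μ ν)) -
        ∫ x, φ (multilinearEval a x) ∂(Measure.pi ν)| ≤
      ∑ i ∈ s, M / 3 * κ i * ∑ S : Finset ι, (∏ j ∈ S, κ j) *
        √(weightedSq (derivOn S (derivOn {i} a))) ^ 3 := by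
  have hκ (i) : 0 ≤ κ i := le_trans (integral_nonneg fun t => by positivity) (hμ i).third
  have hM0 : 0 ≤ M := (abs_nonneg _).trans (hM 0)
  induction s using Finset.induction_on with
  | empty => simp
  | insert i s hi ih =>
    have hst : ∀ j, IsStandard (κ j) (s.piecewise μ ν j) := fun j => by
      by_cases hj : j ∈ s
      · simpa [hj] using hμ j
      · simpa [hj] using hν j
    have hup : Function.update (s.piecewise μ ν) i (ν i) = s.piecewise μ ν := by
      rw [Function.update_eq_self_iff, Finset.piecewise_eq_of_notMem _ _ _ hi]
    have key := abs_integral_update_sub_le hst i (hμ i) (hν i) hφ hM a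
    rw [hup, ← Finset.piecewise_insert] at key
    -- The bound is uniform over the mixed laws, since both vectors share the same `κ`.
    have hyp := integral_abs_pow_three_le_sum hst Finset.univ (derivOn {i} a)
    rw [Finset.piecewise_univ, Finset.powerset_univ] at hyp
    rw [Finset.sum_insert hi]
    refine (abs_sub_le _ _ _).trans (add_le_add (key.trans ?_) ih)
    refine mul_le_mul_of_nonneg_left (hyp.trans (Finset.sum_le_sum fun S _ => ?_))
      (mul_nonneg (by positivity) (hκ i))
    exact mul_le_mul_of_nonneg_left
      (integral_abs_pow_three_rademacher_le Finset.univ _ fun J hJ => absurd (Finset.subset_univ J) hJ)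
      (Finset.prod_nonneg fun j _ => hκ j)

end Lindeberg

/-! ### Weights and influences -/

section Influences

variable {n : ℕ}

lemma upWeight_nonneg (f : MvPolynomial (Fin n) ℝ) (S : Finset (Fin n)) : 0 ≤ upWeight f S :=
  Finset.sum_nonneg fun _ _ => sq_nonneg _

lemma monomialCoeff_eq_zero {d : ℕ} {f : MvPolynomial (Fin n) ℝ} (hd : f.totalDegree ≤ d)
    {J : Finset (Fin n)} (hJ : d < J.card) : monomialCoeff f J = 0 := by
  refine MvPolynomial.coeff_eq_zero_of_totalDegree_lt (hd.trans_lt ?_)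
  rw [← Finsupp.degree_apply, map_sum]
  simpa using hJ

lemma eval_eq_multilinearEval {f : MvPolynomial (Fin n) ℝ} (hf : IsMultilinear f)
    (x : Fin n → ℝ) : MvPolynomial.eval x f = multilinearEval (monomialCoeff f) x := by
  have hsum (J : Finset (Fin n)) (i : Fin n) :
      (∑ j ∈ J, Finsupp.single j 1 : Fin n →₀ ℕ) i = if i ∈ J then 1 else 0 := by
    simp [Finsupp.finsetSum_apply, Finsupp.single_apply]
  have hinj : Function.Injective fun J : Finset (Fin n) =>
      (∑ j ∈ J, Finsupp.single j 1 : Fin n →₀ ℕ) := fun J K h => by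
    ext i
    have := DFunLike.congr_fun h i
    simp only [hsum] at this
    by_cases h1 : i ∈ J <;> by_cases h2 : i ∈ K <;> simp_all
  rw [MvPolynomial.eval_eq', multilinearEval]
  rw [← Finset.sum_image (s := Finset.univ) (g := fun J => ∑ j ∈ J, Finsupp.single j 1)
    (f := fun m : Fin n →₀ ℕ => f.coeff m * ∏ i, x i ^ m i) (hinj.injOn) |>.trans
    (Finset.sum_congr rfl fun J _ => ?_)]
  -- By multilinearity an occurring exponent vector is the indicator of its support.
  · refine Finset.sum_subset (fun m hm => ?_) fun m _ hm => ?_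
    · refine Finset.mem_image.2 ⟨m.support, Finset.mem_univ _, ?_⟩
      ext i
      have h1 : m i ≤ 1 := (MvPolynomial.monomial_le_degreeOf i hm).trans (hf i)
      rw [hsum]
      by_cases h0 : m i = 0
      · simp [h0]
      · rw [if_pos (by simpa using h0)]; omega
    · rw [MvPolynomial.notMem_support_iff.1 hm, zero_mul]
  · rw [monomialCoeff]
    congr 1
    simp only [hsum, pow_ite, pow_one, pow_zero]
    simp

/-- The coefficients of `∂_S f` are those of `f` on supersets of `S`. Rounding `3^d` up to `4^d`
makes the square root `2^d`. -/
lemma weightedSq_derivOn_le {d : ℕ} {f : MvPolynomial (Fin n) ℝ} (hd : f.totalDegree ≤ d)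
    (S : Finset (Fin n)) :
    weightedSq (derivOn S (monomialCoeff f)) ≤ 4 ^ d * upWeight f S := by
  have h1 : weightedSq (derivOn S (monomialCoeff f)) =
      ∑ J with Disjoint S J, 3 ^ J.card * monomialCoeff f (S ∪ J) ^ 2 := by
    rw [weightedSq, Finset.sum_filter]
    exact Finset.sum_congr rfl fun J _ => by by_cases h : Disjoint S J <;> simp [derivOn, h]
  rw [h1, upWeight, Finset.mul_sum]
  have hinj : Set.InjOn (fun J => S ∪ J) (Finset.univ.filter (Disjoint S ·) : Finset _) := by
    intro J hJ K hK h
    simp only [Finset.coe_filter, Finset.mem_univ, true_and, Set.mem_ofPred_eq] at hJ hK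
    have := congrArg (· \ S) h
    simpa [Finset.union_sdiff_left, Finset.sdiff_eq_self_of_disjoint hJ.symm,
      Finset.sdiff_eq_self_of_disjoint hK.symm] using this
  calc _ ≤ ∑ J with Disjoint S J, 4 ^ d * monomialCoeff f (S ∪ J) ^ 2 := by
        refine Finset.sum_le_sum fun J _ => ?_
        by_cases h : d < (S ∪ J).card
        · simp [monomialCoeff_eq_zero hd h]
        · refine mul_le_mul_of_nonneg_right ?_ (sq_nonneg _)
          calc (3 : ℝ) ^ J.card ≤ 3 ^ d := pow_le_pow_right₀ (by norm_num)
                ((Finset.card_le_card Finset.subset_union_right).trans (not_lt.1 h))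
            _ ≤ 4 ^ d := by gcongr; norm_num
    _ = ∑ J ∈ (Finset.univ.filter (Disjoint S ·)).image (S ∪ ·),
          4 ^ d * monomialCoeff f J ^ 2 := by rw [Finset.sum_image hinj]
    _ ≤ _ := by
        refine Finset.sum_le_sum_of_subset_of_nonneg ?_ fun J _ _ => by positivity
        intro J hJ
        obtain ⟨K, -, rfl⟩ := Finset.mem_image.1 hJ
        simp

/-- One factor `√W_S` joins the product of the `σ_i⁻¹` to form `√I_S`; the other two leave `W_S`. -/
lemma prod_mul_sqrt_pow_three_le {d : ℕ} {f : MvPolynomial (Fin n) ℝ} (hd : f.totalDegree ≤ d)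
    {σ : Fin n → ℝ} (hσ : ∀ i, 0 < σ i) {ε : ℝ} {S : Finset (Fin n)}
    (hε : genInfluence σ f S ≤ ε) :
    (∏ i ∈ S, (σ i)⁻¹) * √(weightedSq (derivOn S (monomialCoeff f))) ^ 3 ≤
      8 ^ d * √ε * upWeight f S := by
  have hW := upWeight_nonneg f S
  have hp : 0 ≤ ∏ i ∈ S, (σ i)⁻¹ := Finset.prod_nonneg fun i _ => (inv_pos.2 (hσ i)).le
  have h1 : √(weightedSq (derivOn S (monomialCoeff f))) ≤ 2 ^ d * √(upWeight f S) := by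
    refine (Real.sqrt_le_sqrt (weightedSq_derivOn_le hd S)).trans (le_of_eq ?_)
    rw [Real.sqrt_mul (by positivity), show (4 : ℝ) ^ d = (2 ^ d) ^ 2 by
      rw [← pow_mul, mul_comm, pow_mul]; norm_num, Real.sqrt_sq (by positivity)]
  have h2 : (∏ i ∈ S, (σ i)⁻¹) * √(upWeight f S) ≤ √ε := by
    refine Real.le_sqrt_of_sq_le (le_trans (le_of_eq ?_) hε)
    rw [mul_pow, Real.sq_sqrt hW, ← Finset.prod_pow, genInfluence, mul_comm]
    simp only [inv_pow]
  calc _ ≤ (∏ i ∈ S, (σ i)⁻¹) * (2 ^ d * √(upWeight f S)) ^ 3 := by gcongr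
    _ = (2 ^ d) ^ 3 * ((∏ i ∈ S, (σ i)⁻¹) * √(upWeight f S)) * √(upWeight f S) ^ 2 := by ring
    _ ≤ (2 ^ d) ^ 3 * √ε * √(upWeight f S) ^ 2 := by gcongr
    _ = _ := by
        rw [Real.sq_sqrt hW, ← pow_mul, mul_comm d, pow_mul]
        norm_num

/-- Double counting: after dropping `i ∉ S`, each `J` is counted once per `i ∈ J` and `S ⊆ J`, that
is `|J| 2^|J|` times. -/
lemma sum_upWeight_insert_le {d : ℕ} {f : MvPolynomial (Fin n) ℝ} (hd : f.totalDegree ≤ d) :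
    ∑ i, ∑ S with i ∉ S, upWeight f (insert i S) ≤ d * 2 ^ d * upWeight f ∅ := by
  have h1 : ∑ i, ∑ S with i ∉ S, upWeight f (insert i S) ≤
      ∑ i, ∑ S : Finset (Fin n), ∑ J, if i ∈ J ∧ S ⊆ J then monomialCoeff f J ^ 2 else 0 := by
    refine Finset.sum_le_sum fun i _ => ?_
    refine (Finset.sum_le_sum_of_subset_of_nonneg (Finset.filter_subset _ _)
      fun S _ _ => upWeight_nonneg f _).trans (le_of_eq ?_)
    refine Finset.sum_congr rfl fun S _ => ?_
    simp only [upWeight, Finset.insert_subset_iff, Finset.sum_filter]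
  refine h1.trans ?_
  have h2 : ∑ i, ∑ S : Finset (Fin n), ∑ J,
      (if i ∈ J ∧ S ⊆ J then monomialCoeff f J ^ 2 else 0) =
      ∑ J, (J.card * 2 ^ J.card : ℝ) * monomialCoeff f J ^ 2 := by
    rw [Finset.sum_congr rfl fun i _ => Finset.sum_comm, Finset.sum_comm]
    refine Finset.sum_congr rfl fun J _ => ?_
    simp only [ite_and]
    have h3 (S : Finset (Fin n)) : S ⊆ J ↔ S ∈ J.powerset := Finset.mem_powerset.symm
    simp only [Finset.sum_ite_irrel, h3, Finset.sum_ite_mem, Finset.sum_const_zero,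
      Finset.univ_inter, Finset.sum_const, Finset.card_powerset, nsmul_eq_mul]
    push_cast
    ring
  rw [h2, upWeight, Finset.mul_sum]
  simp only [Finset.empty_subset, Finset.filter_true]
  refine Finset.sum_le_sum fun J _ => ?_
  by_cases h : d < J.card
  · simp [monomialCoeff_eq_zero hd h]
  · have h := not_lt.1 h
    gcongr
    norm_num

end Influences

/-! ### From random vectors to product laws -/

section Admissible

variable {n : ℕ} {Ω : Type*} [MeasurableSpace Ω] {P : Measure Ω} [IsProbabilityMeasure P]
  {σ : Fin n → ℝ} {X : Fin n → Ω → ℝ}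

lemma IsAdmissible.isStandard_map (h : IsAdmissible P σ X) (hσ : ∀ i, 0 < σ i) (i : Fin n) :
    IsStandard (σ i)⁻¹ (P.map (X i)) := by
  have hm := (h.measurable i).aemeasurable (μ := P)
  have h3 := h.third_moment i
  have hL : MemLp (X i) 3 P := by
    refine ⟨(h.measurable i).aestronglyMeasurable, ?_⟩
    have := h3.trans_lt ENNReal.ofReal_lt_top
    -- The moment bound is finite, which already forces membership in `L³`.
    by_contra htop
    rw [not_lt, top_le_iff] at htop
    simp [htop] at this
  refine ⟨Measure.isProbabilityMeasure_map hm, ?_, ?_, ?_, ?_⟩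
  · exact (memLp_map_measure_iff aestronglyMeasurable_id hm).2 hL
  · rw [integral_map hm (by fun_prop)]
    exact h.mean i
  · rw [integral_map hm (by fun_prop), ← h.variance i, variance_eq_integral hm, h.mean i]
    simp
  · rw [integral_map hm (by fun_prop)]
    rw [hL.eLpNorm_eq_integral_rpow_norm (by norm_num) (by norm_num),
      ← ENNReal.ofReal_pow (by positivity),
      ENNReal.ofReal_le_ofReal_iff (inv_pos.2 (hσ i)).le, ENNReal.toReal_ofNat,
      ← Real.rpow_natCast, ← Real.rpow_mul (by positivity)] at h3
    norm_num at h3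
    exact h3

lemma IsAdmissible.map_eq_pi (h : IsAdmissible P σ X) :
    P.map (fun ω i => X i ω) = Measure.pi fun i => P.map (X i) :=
  (iIndepFun_iff_map_fun_eq_pi_map fun i => (h.measurable i).aemeasurable).1 h.indep

/-- The law of `φ(f(X))` depends only on the product of the laws of the coordinates. -/
lemma IsAdmissible.integral_comp_evalAt (h : IsAdmissible P σ X) (hσ : ∀ i, 0 < σ i)
    {f : MvPolynomial (Fin n) ℝ} (hf : IsMultilinear f) {φ : ℝ → ℝ} (hφ : ContDiff ℝ 3 φ)
    {M : ℝ} (hM : ∀ x, |iteratedDeriv 3 φ x| ≤ M) :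
    Integrable (fun ω => φ (evalAt f X ω)) P ∧
    ∫ ω, φ (evalAt f X ω) ∂P =
      ∫ x, φ (multilinearEval (monomialCoeff f) x) ∂(Measure.pi fun i => P.map (X i)) := by
  have hs := h.isStandard_map hσ
  have := fun i => (hs i).prob
  have hm : Measurable fun ω i => X i ω := measurable_pi_iff.2 h.measurable
  have hint := integrable_comp_of_memLp_three hφ hM (memLp_multilinearEval hs (monomialCoeff f))
  rw [← h.map_eq_pi] at hint ⊢
  rw [integral_map hm.aemeasurable hint.aestronglyMeasurable]
  simp only [evalAt, eval_eq_multilinearEval hf, and_true]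
  exact hint.comp_measurable hm

end Admissible

end Invariance

open Invariance

theorem mainTheorem8 {n : ℕ} (d : ℕ)
    {Ω : Type*} [MeasurableSpace Ω] (P : Measure Ω) [IsProbabilityMeasure P]
    {Ω' : Type*} [MeasurableSpace Ω'] (P' : Measure Ω') [IsProbabilityMeasure P']
    (σ : Fin n → ℝ) (hσ : ∀ i, 0 < σ i)
    (X : Fin n → Ω → ℝ) (Y : Fin n → Ω' → ℝ)
    (hX : Invariance.IsAdmissible P σ X) (hY : Invariance.IsAdmissible P' σ Y)
    (f : MvPolynomial (Fin n) ℝ) (hf : Invariance.IsMultilinear f) (hd : f.totalDegree ≤ d)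
    (φ : ℝ → ℝ) (hφ : ContDiff ℝ 3 φ)
    (hφ3 : BddAbove (Set.range fun x => |iteratedDeriv 3 φ x|))
    (ε : ℝ)
    (hε : ∀ S : Finset (Fin n), S.Nonempty → Invariance.genInfluence σ f S ≤ ε) :
    Integrable (fun ω => φ (Invariance.evalAt f X ω)) P ∧
    Integrable (fun ω => φ (Invariance.evalAt f Y ω)) P' ∧
    |(∫ ω, φ (Invariance.evalAt f X ω) ∂P) - ∫ ω, φ (Invariance.evalAt f Y ω) ∂P'|
      ≤ 2 ^ (5 * d) * Invariance.thirdDerivSup φ * Invariance.upWeight f ∅ * √ε := by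
  have hM : ∀ x, |iteratedDeriv 3 φ x| ≤ thirdDerivSup φ := fun x => le_ciSup hφ3 x
  have hM0 : 0 ≤ thirdDerivSup φ := (abs_nonneg _).trans (hM 0)
  obtain ⟨hX1, hX2⟩ := hX.integral_comp_evalAt hσ hf hφ hM
  obtain ⟨hY1, hY2⟩ := hY.integral_comp_evalAt hσ hf hφ hM
  refine ⟨hX1, hY1, ?_⟩
  have key := abs_integral_pi_sub_le (hX.isStandard_map hσ) (hY.isStandard_map hσ) hφ hM
    (monomialCoeff f) Finset.univ
  rw [Finset.piecewise_univ] at key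
  rw [hX2, hY2]
  refine key.trans ?_
  have hbound (i : Fin n) : (σ i)⁻¹ * ∑ S : Finset (Fin n), (∏ j ∈ S, (σ j)⁻¹) *
      √(weightedSq (derivOn S (derivOn {i} (monomialCoeff f)))) ^ 3 ≤
      8 ^ d * √ε * ∑ S with i ∉ S, upWeight f (insert i S) := by
    rw [Finset.mul_sum, Finset.mul_sum, Finset.sum_filter]
    refine Finset.sum_le_sum fun S _ => ?_
    -- Differentiating twice in `v_i` gives zero, so only `S` without `i` contribute.
    by_cases hi : i ∈ S
    · simp [hi, derivOn_derivOn_singleton_of_mem hi, weightedSq]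
    · rw [if_pos hi, derivOn_derivOn_singleton hi, ← mul_assoc,
        ← Finset.prod_insert (f := fun j => (σ j)⁻¹) hi]
      exact prod_mul_sqrt_pow_three_le hd hσ (hε _ (Finset.insert_nonempty i S))
  -- This absorbs `d`, giving `8^d · 2^d · 2^d = 2^(5d)`; the factor 1/3 is discarded.
  have hd2 : (d : ℝ) ≤ 2 ^ d := by exact_mod_cast d.lt_two_pow_self.le
  calc _ = thirdDerivSup φ / 3 * ∑ i, (σ i)⁻¹ * ∑ S : Finset (Fin n), (∏ j ∈ S, (σ j)⁻¹) *
          √(weightedSq (derivOn S (derivOn {i} (monomialCoeff f)))) ^ 3 := by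
        rw [Finset.mul_sum]
        exact Finset.sum_congr rfl fun i _ => mul_assoc _ _ _
    _ ≤ thirdDerivSup φ / 3 * (8 ^ d * √ε * (d * 2 ^ d * upWeight f ∅)) := by
        refine mul_le_mul_of_nonneg_left ?_ (by positivity)
        refine (Finset.sum_le_sum fun i _ => hbound i).trans ?_
        rw [← Finset.mul_sum]
        exact mul_le_mul_of_nonneg_left (sum_upWeight_insert_le hd) (by positivity)
    _ ≤ thirdDerivSup φ * (8 ^ d * √ε * (2 ^ d * 2 ^ d * upWeight f ∅)) := by
        have := upWeight_nonneg f ∅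
        gcongr
        linarith
    _ = _ := by
        rw [pow_mul, show (2 : ℝ) ^ 5 = 8 * 2 * 2 by norm_num, mul_pow, mul_pow]
        ring
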